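/- Let $R$ be a nontrivial commutative Noetherian ring (for instance $R=\mathbb{Z}$), and let $k\ge 2$ be an integer. A sequence $(u_n)_{n\ge 0}$ of integers is called $k$-regular (over $R$) if the $R$-module generated by the subsequences $(u_{k^i n+j})_{n\ge 0}$, $i\ge 0$, $0\le j\le k^i-1$ (regarded as sequences in $R$ via $\mathbb{Z}\to R$), is finitely generated. (1) Let $b\ge 2$ be an integer and let $\alpha,\beta$ be real numbers such that $\alpha n+\beta>0$ for all sufficiently large $n$ (that is, $\alpha>0$, or $\alpha=0$ and $\beta>0$). Let $(u_n)_{n\ge 0}$ be a sequence of integers with $u_n=\lfloor\log_b(\alpha n+\beta)\rfloor$ for every $n\ge 0$ with $\alpha n+\beta>0$, the values $u_n$ at the finitely many other $n$ being arbitrary integers. Then $(u_n)_{n\ge 0}$ is $b$-regular if and only if $\alpha$ is rational. (2) In particular (taking $\alpha=\sqrt2$, $\beta=0$, $b=2$), the sequence $\left(\lfloor \tfrac12+\log_2 n\rfloor\right)_{n\ge 0}$, with any integer as its value at $n=0$, is not $2$-regular. -/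

import Mathlib

/-- The `k`-kernel of a sequence `u`: the set of all subsequences `n ↦ u (k ^ i * n + j)` with
`i ≥ 0` and `0 ≤ j ≤ k ^ i - 1`. -/
def kKernel {M : Type*} (k : ℕ) (u : ℕ → M) : Set (ℕ → M) :=
  {s | ∃ i j : ℕ, j < k ^ i ∧ s = fun n => u (k ^ i * n + j)}

/-- A sequence `u` is `k`-regular over the (commutative Noetherian) ring `R` if the `R`-module
generated by its `k`-kernel is finitely generated. -/
def IsRegularSeq (R : Type*) {M : Type*} [CommRing R] [AddCommGroup M] [Module R M]
    (k : ℕ) (u : ℕ → M) : Prop :=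
  (Submodule.span R (kKernel k u)).FG

/-! Write `α(b^i n + j) + β = b^i (α n + x)` with `x = (α j + β) / b^i` bounded, so the logarithm's
floor is `i + ⌊log_b(α n + x)⌋`. If `α = p/q > 0`, the test `b^m ≤ α n + x` sees only `⌊q x⌋`, which
takes finitely many values (`isRegularSeq_of_rat`). If `α` is irrational, the residues `ρ` of
distinct powers of `b` modulo `α` are distinct, and at `n = ⌊b^(m+1)/α⌋` the value jumps by 1 as `α
j + β` passes `b^i ρ`. For large `i` these jumps occur at different `j`, so differences of
neighbouring kernel elements give arbitrarily many independent coordinates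
(`not_isRegularSeq_of_irrational`). -/

theorem pos_of_eventually_pos {α β : ℝ} (hα : α ≠ 0)
    (h : ∀ᶠ n : ℕ in Filter.atTop, 0 < α * n + β) : 0 < α := by
  by_contra hneg
  have hlt : α < 0 := lt_of_le_of_ne (not_lt.1 hneg) hα
  have ht := (tendsto_natCast_atTop_atTop (R := ℝ)).eventually_ge_atTop (β / -α)
  obtain ⟨n, h1, h2⟩ := (h.and ht).exists
  rw [div_le_iff₀ (by linarith)] at h2
  linarith

theorem floor_logb_eq {b k : ℕ} (hb : 2 ≤ b) {A : ℝ} (h₁ : (b : ℝ) ^ k ≤ A)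
    (h₂ : A < (b : ℝ) ^ (k + 1)) : ⌊Real.logb b A⌋ = (k : ℤ) := by
  have hb' : (1 : ℝ) < b := by exact_mod_cast hb
  have hA : 0 < A := lt_of_lt_of_le (by positivity) h₁
  rw [Int.floor_eq_iff]
  constructor
  · rw [Real.le_logb_iff_rpow_le hb' hA]
    simpa using h₁
  · rw [Real.logb_lt_iff_lt_rpow hb' hA]
    exact_mod_cast h₂

theorem floor_logb_congr {b : ℕ} (hb : 2 ≤ b) {A B : ℝ} (hA : 1 ≤ A)
    (h : ∀ m : ℕ, (b : ℝ) ^ m ≤ A ↔ (b : ℝ) ^ m ≤ B) :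
    ⌊Real.logb b A⌋ = ⌊Real.logb b B⌋ := by
  have hb' : (1 : ℝ) < b := by exact_mod_cast hb
  obtain ⟨k, hk, hk'⟩ := exists_nat_pow_near hA hb'
  rw [floor_logb_eq hb hk hk', floor_logb_eq hb ((h k).1 hk)]
  rw [← not_le, ← h, not_le]
  exact hk'

/-- Sampling at `d + 1` points sends `d` generators to at most `d` vectors, which cannot span
`R^(d+1)`. -/
theorem Submodule.FG.exists_not_forall_single {R : Type*} [CommRing R] [Nontrivial R]
    {V : Submodule R (ℕ → R)} (hV : V.FG) :
    ∃ N : ℕ, ∀ c : Fin N → ℕ, ¬ ∀ t, ∃ f ∈ V, ∀ s, f (c s) = if s = t then 1 else 0 := by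
  obtain ⟨S, rfl⟩ := hV
  refine ⟨S.card + 1, fun c h => ?_⟩
  classical
  let π : (ℕ → R) →ₗ[R] (Fin (S.card + 1) → R) := LinearMap.funLeft R R c
  have htop : Submodule.span R ((S.image π : Finset (Fin (S.card + 1) → R)) :
      Set (Fin (S.card + 1) → R)) = ⊤ := by
    rw [Finset.coe_image, Submodule.span_image, eq_top_iff,
      ← (Pi.basisFun R (Fin (S.card + 1))).span_eq, Submodule.span_le]
    rintro _ ⟨t, rfl⟩
    obtain ⟨f, hf, hfc⟩ := h t
    refine ⟨f, hf, ?_⟩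
    ext s
    simp [π, LinearMap.funLeft_apply, hfc, Pi.single_apply]
  have h1 := basis_le_span' (Pi.basisFun R (Fin (S.card + 1))) htop
  have h2 : (S.image π).card ≤ S.card := Finset.card_image_le
  simp only [Cardinal.mk_fin, Nat.cast_le, SetLike.coe_sort_coe, Fintype.card_coe] at h1
  omega

theorem mem_of_eq_of_le {R : Type*} [CommRing R] {W : Submodule R (ℕ → R)} {N : ℕ}
    (hW : ∀ m < N, Pi.single m 1 ∈ W) {f g : ℕ → R} (hg : g ∈ W)
    (hfg : ∀ n, N ≤ n → f n = g n) : f ∈ W := by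
  have : f = g + ∑ m ∈ Finset.range N, (f m - g m) • (Pi.single m 1 : ℕ → R) := by
    ext n
    simp only [Pi.add_apply, Finset.sum_apply, Pi.smul_apply, Pi.single_apply, smul_eq_mul,
      mul_ite, mul_one, mul_zero, Finset.sum_ite_eq, Finset.mem_range]
    split_ifs with h
    · ring
    · rw [hfg n (not_lt.1 h), add_zero]
  rw [this]
  exact W.add_mem hg (W.sum_mem fun m hm => W.smul_mem _ (hW m (Finset.mem_range.1 hm)))

/-- Finitely many unit sequences absorb the terms below `N`; Noetherianity passes finite generation
to the submodule. -/
theorem isRegularSeq_of_eventually {R : Type*} [CommRing R] [IsNoetherianRing R] {k : ℕ}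
    {u : ℕ → R} {S : Set (ℕ → R)} (hS : S.Finite) (N : ℕ)
    (h : ∀ i j : ℕ, j < k ^ i → ∃ g ∈ Submodule.span R S, ∀ n, N ≤ n → u (k ^ i * n + j) = g n) :
    IsRegularSeq R k u := by
  have hfin : (S ∪ (fun m : ℕ => (Pi.single m 1 : ℕ → R)) '' Set.Iio N).Finite :=
    hS.union ((Set.finite_Iio N).image _)
  refine Submodule.FG.of_le (Submodule.fg_span hfin) ?_
  rw [Submodule.span_le]
  rintro _ ⟨i, j, hj, rfl⟩
  obtain ⟨g, hg, hgn⟩ := h i j hj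
  refine mem_of_eq_of_le (N := N) (fun m hm => Submodule.subset_span (Or.inr ⟨m, hm, rfl⟩))
    (Submodule.span_mono Set.subset_union_left hg) hgn

theorem isRegularSeq_of_rat {R : Type*} [CommRing R] [IsNoetherianRing R] {b : ℕ} (hb : 2 ≤ b)
    (r : ℚ) {β : ℝ} (hpos : ∀ᶠ n : ℕ in Filter.atTop, 0 < (r : ℝ) * n + β) {u : ℕ → ℤ}
    (hu : ∀ n : ℕ, 0 < (r : ℝ) * n + β → u n = ⌊Real.logb b (r * n + β)⌋) :
    IsRegularSeq R b (fun n => (u n : R)) := by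
  obtain ⟨N, hN⟩ := Filter.eventually_atTop.1 hpos
  have hb1 : (1 : ℝ) < b := by exact_mod_cast hb
  have hle : ∀ i n j : ℕ, n ≤ b ^ i * n + j := fun i n j =>
    (Nat.le_mul_of_pos_left n (by positivity)).trans (Nat.le_add_right _ _)
  rcases lt_trichotomy (r : ℝ) 0 with hr | hr | hr
  · exact absurd (pos_of_eventually_pos hr.ne hpos) hr.le.not_gt
  · simp only [hr, zero_mul, zero_add] at hN hu
    refine isRegularSeq_of_eventually (S := {fun _ => ((⌊Real.logb b β⌋ : ℤ) : R)})
      (Set.finite_singleton _) 0 fun i j _ =>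
        ⟨_, Submodule.subset_span rfl, fun n _ => ?_⟩
    rw [hu _ (hN N le_rfl)]
  · have hq : (0 : ℝ) < r.den := by exact_mod_cast r.den_pos
    have hrq : (r.den : ℝ) * r = r.num := by exact_mod_cast Rat.den_mul_eq_num r
    let G : ℤ → ℕ → R := fun c n => ((⌊Real.logb b (r * n + c / r.den)⌋ : ℤ) : R)
    let D : ℝ := r.den * (r + |β|)
    -- Beyond `N'`, `r n + x ≥ 1`, so only nonnegative powers of `b` matter.
    obtain ⟨N', hN'⟩ := exists_nat_gt ((|β| + 2) / r)
    rw [div_lt_iff₀ hr] at hN'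
    refine isRegularSeq_of_eventually
      (S := {fun _ => 1} ∪ G '' Set.Icc ⌊-D⌋ ⌊D⌋)
      ((Set.finite_singleton _).union ((Set.finite_Icc _ _).image _)) (max N N') fun i j hj => ?_
    have hbi : (1 : ℝ) ≤ (b : ℝ) ^ i := one_le_pow₀ hb1.le
    have hbi0 : (0 : ℝ) < (b : ℝ) ^ i := by linarith
    have hj' : (j : ℝ) < (b : ℝ) ^ i := by exact_mod_cast hj
    set x : ℝ := (r * j + β) / (b : ℝ) ^ i with hx
    have hxb : x * (b : ℝ) ^ i = r * j + β := div_mul_cancel₀ _ hbi0.ne'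
    have hβ := abs_nonneg β
    have hβ1 := le_abs_self β
    have hβ2 := neg_abs_le β
    have hj0 : (0 : ℝ) ≤ r * j := by positivity
    have hx1 : x ≤ r + |β| := by
      rw [hx, div_le_iff₀ hbi0]
      nlinarith
    have hx2 : -|β| ≤ x := by
      rw [hx, le_div_iff₀ hbi0]
      nlinarith
    set c : ℤ := ⌊r.den * x⌋ with hc
    have hcmem : c ∈ Set.Icc ⌊-D⌋ ⌊D⌋ := by
      refine ⟨Int.floor_mono ?_, Int.floor_mono ?_⟩
      · simp only [D]; nlinarith
      · simp only [D]; nlinarith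
    refine ⟨(i : R) • (fun _ => 1) + G c, Submodule.add_mem _ (Submodule.smul_mem _ _
      (Submodule.subset_span (Or.inl rfl))) (Submodule.subset_span (Or.inr ⟨c, hcmem, rfl⟩)),
      fun n hn => ?_⟩
    have hnN : N ≤ n := (le_max_left _ _).trans hn
    have hnN' : (N' : ℝ) ≤ n := by exact_mod_cast (le_max_right _ _).trans hn
    have hrn : |β| + 2 < r * n := by nlinarith
    have hA : (r : ℝ) * ((b ^ i * n + j : ℕ) : ℝ) + β = (b : ℝ) ^ i * (r * n + x) := by
      push_cast
      linear_combination -hxb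
    have key : ⌊Real.logb b (r * n + x)⌋ = ⌊Real.logb b (r * n + c / r.den)⌋ := by
      refine floor_logb_congr hb (by linarith) fun m => ?_
      have e1 : (b : ℝ) ^ m ≤ r * n + x ↔ ((r.den * b ^ m - r.num * n : ℤ) : ℝ) ≤ r.den * x := by
        push_cast
        rw [← hrq, ← mul_le_mul_iff_right₀ hq]
        constructor <;> intro h <;> nlinarith
      have e2 : (b : ℝ) ^ m ≤ r * n + c / r.den ↔ (r.den * b ^ m - r.num * n : ℤ) ≤ c := by
        rw [← Int.cast_le (R := ℝ)]
        push_cast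
        rw [← hrq, ← mul_le_mul_iff_right₀ hq, mul_add, mul_div_cancel₀ _ hq.ne']
        constructor <;> intro h <;> linarith
      rw [e1, e2, hc, Int.le_floor]
    have hval : u (b ^ i * n + j) = i + ⌊Real.logb b (r * n + c / r.den)⌋ := by
      rw [hu _ (hN _ (hnN.trans (hle i n j))), hA, Real.logb_mul hbi0.ne' (by linarith),
        Real.logb_pow, Real.logb_self_eq_one hb1, mul_one, Int.floor_natCast_add, key]
    simp [hval, G]

theorem not_isRegularSeq_of_irrational {R : Type*} [CommRing R] [Nontrivial R] {b : ℕ}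
    (hb : 2 ≤ b) {α β : ℝ} (hα : Irrational α) (hα0 : 0 < α) {u : ℕ → ℤ}
    (hu : ∀ n : ℕ, 0 < α * n + β → u n = ⌊Real.logb b (α * n + β)⌋) :
    ¬ IsRegularSeq R b (fun n => (u n : R)) := by
  intro hreg
  obtain ⟨N, hN⟩ := Submodule.FG.exists_not_forall_single hreg
  have hb2 : (2 : ℝ) ≤ b := by exact_mod_cast hb
  have hb1 : (1 : ℝ) < b := by linarith
  have hβ := abs_nonneg β
  have hβ1 := le_abs_self β
  have hβ2 := neg_abs_le β
  -- This keeps the sampled arguments within one factor `b` of `b^(i+m+1)`, on either side.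
  obtain ⟨M, hM⟩ := pow_unbounded_of_one_lt (α + |β|) hb1
  let m : Fin N → ℕ := fun t => M + t
  let c : Fin N → ℕ := fun t => ⌊(b : ℝ) ^ (m t + 1) / α⌋₊
  let ρ : Fin N → ℝ := fun t => (b : ℝ) ^ (m t + 1) - α * c t
  have hρ1 : ∀ t, ρ t < α := fun t => by
    have := Nat.lt_floor_add_one ((b : ℝ) ^ (m t + 1) / α)
    rw [div_lt_iff₀ hα0] at this
    simp only [ρ, c]
    linarith
  have hρ0 : ∀ t, 0 < ρ t := fun t => by
    have h1 := Nat.floor_le (show 0 ≤ (b : ℝ) ^ (m t + 1) / α by positivity)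
    rw [le_div_iff₀ hα0] at h1
    rcases h1.lt_or_eq with h | h
    · simp only [ρ, c]
      linarith
    · exfalso
      have hne : (⌊(b : ℝ) ^ (m t + 1) / α⌋₊ : ℝ) ≠ 0 := by
        intro h0
        rw [h0, zero_mul] at h
        have : (0 : ℝ) < (b : ℝ) ^ (m t + 1) := by positivity
        linarith
      refine hα ⟨(b : ℚ) ^ (m t + 1) / (⌊(b : ℝ) ^ (m t + 1) / α⌋₊ : ℚ), ?_⟩
      push_cast
      rw [div_eq_iff hne, mul_comm, h]
  have hρne : ∀ s t, s ≠ t → ρ s ≠ ρ t := fun s t hst h => by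
    have hpow : (b : ℝ) ^ (m s + 1) ≠ (b : ℝ) ^ (m t + 1) := by
      intro h'
      have := pow_right_injective₀ (by linarith) hb1.ne' h'
      simp only [m] at this
      exact hst (Fin.ext (by omega))
    simp only [ρ] at h
    have hc : (c s : ℝ) - c t ≠ 0 := by
      intro h0
      apply hpow
      linear_combination h + α * h0
    refine hα ⟨((b : ℚ) ^ (m s + 1) - (b : ℚ) ^ (m t + 1)) / ((c s : ℚ) - c t), ?_⟩
    push_cast
    rw [div_eq_iff hc]
    linear_combination h
  have hlarge : ∀ x y : ℝ, 0 < x → ∀ᶠ i : ℕ in Filter.atTop, y < (b : ℝ) ^ i * x := fun x y hx =>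
    ((tendsto_pow_atTop_atTop_of_one_lt hb1).atTop_mul_const hx).eventually_gt_atTop y
  -- The first two bounds place the jump for `t` between some `j` and `j + 1 < b^i`; the gap `2α`
  -- exceeds the step `α`, so no other `s` jumps there.
  have hex : ∀ᶠ i : ℕ in Filter.atTop, ∀ t, β < (b : ℝ) ^ i * ρ t ∧
      α - β < (b : ℝ) ^ i * (α - ρ t) ∧
      ∀ s, s ≠ t → 2 * α < (b : ℝ) ^ i * |ρ s - ρ t| := by
    simp only [Filter.eventually_all, Filter.eventually_and]
    refine fun t => ⟨hlarge _ _ (hρ0 t), hlarge _ _ (sub_pos.2 (hρ1 t)), fun s hs => ?_⟩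
    exact hlarge _ _ (abs_pos.2 (sub_ne_zero.2 (hρne s t hs)))
  obtain ⟨i, hi⟩ := hex.exists
  have hbi : (1 : ℝ) ≤ (b : ℝ) ^ i := one_le_pow₀ hb1.le
  have hupper : ∀ (s : Fin N) (j : ℕ), j < b ^ i → (b : ℝ) ^ i * ρ s ≤ α * j + β →
      u (b ^ i * c s + j) = (i + m s + 1 : ℕ) := fun s j hj h => by
    have hj' : (j : ℝ) < (b : ℝ) ^ i := by exact_mod_cast hj
    have hA : α * ((b ^ i * c s + j : ℕ) : ℝ) + β =
        (b : ℝ) ^ (i + m s + 1) - (b : ℝ) ^ i * ρ s + (α * j + β) := by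
      simp only [ρ]; push_cast; ring
    have hM' : (b : ℝ) ^ M ≤ (b : ℝ) ^ (m s + 1) := pow_le_pow_right₀ hb1.le (by simp [m]; omega)
    have hpos : 0 < (b : ℝ) ^ (i + m s + 1) := by positivity
    rw [hu _ (by rw [hA]; linarith), hA]
    refine floor_logb_eq hb (by linarith) ?_
    have e1 : (b : ℝ) ^ (i + m s + 1) = (b : ℝ) ^ i * (b : ℝ) ^ (m s + 1) := by ring
    have e2 : (b : ℝ) ^ (i + m s + 1 + 1) = (b : ℝ) ^ (i + m s + 1) * b := by ring
    have h1 : (b : ℝ) ^ (i + m s + 1) * 2 ≤ (b : ℝ) ^ (i + m s + 1) * b := by gcongr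
    have h2 : (b : ℝ) ^ i * (α + |β|) < (b : ℝ) ^ i * (b : ℝ) ^ (m s + 1) := by
      gcongr; linarith
    have h3 : 0 < (b : ℝ) ^ i * ρ s := mul_pos (by linarith) (hρ0 s)
    nlinarith
  have hlower : ∀ (s : Fin N) (j : ℕ), α * j + β < (b : ℝ) ^ i * ρ s →
      u (b ^ i * c s + j) = (i + m s : ℕ) := fun s j h => by
    have hA : α * ((b ^ i * c s + j : ℕ) : ℝ) + β =
        (b : ℝ) ^ (i + m s + 1) - (b : ℝ) ^ i * ρ s + (α * j + β) := by
      simp only [ρ]; push_cast; ring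
    have hM' : (b : ℝ) ^ M ≤ (b : ℝ) ^ (m s) := pow_le_pow_right₀ hb1.le (by simp [m])
    have e1 : (b : ℝ) ^ (i + m s) = (b : ℝ) ^ i * (b : ℝ) ^ (m s) := by ring
    have e2 : (b : ℝ) ^ (i + m s + 1) = (b : ℝ) ^ (i + m s) * b := by ring
    have h1 : (b : ℝ) ^ (i + m s) * 2 ≤ (b : ℝ) ^ (i + m s) * b := by gcongr
    have h2 : (b : ℝ) ^ i * (α + |β|) < (b : ℝ) ^ i * (b : ℝ) ^ (m s) := by
      gcongr; linarith
    have h3 : (b : ℝ) ^ i * ρ s ≤ (b : ℝ) ^ i * α := by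
      gcongr; exact (hρ1 s).le
    have h4 : 0 ≤ α * j := by positivity
    have h5 : 0 < (b : ℝ) ^ (i + m s) := by positivity
    have h6 : (b : ℝ) ^ (i + m s) ≤ α * ((b ^ i * c s + j : ℕ) : ℝ) + β := by
      rw [hA]; nlinarith
    rw [hu _ (by linarith)]
    exact floor_logb_eq hb h6 (by rw [hA]; linarith)
  refine hN c fun t => ?_
  obtain ⟨h1, h2, h3⟩ := hi t
  have hpos : 0 < ((b : ℝ) ^ i * ρ t - β) / α := div_pos (by linarith) hα0
  obtain ⟨j, hj⟩ : ∃ j, ⌈((b : ℝ) ^ i * ρ t - β) / α⌉₊ = j + 1 :=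
    Nat.exists_eq_succ_of_ne_zero (Nat.ceil_pos.2 hpos).ne'
  have hj1 := Nat.le_ceil (((b : ℝ) ^ i * ρ t - β) / α)
  have hj2 := Nat.ceil_lt_add_one hpos.le
  rw [hj, div_le_iff₀ hα0] at hj1
  rw [hj, div_add_one hα0.ne', lt_div_iff₀ hα0] at hj2
  push_cast at hj1 hj2
  have hjb : j + 1 < b ^ i := by
    have : ((j : ℝ) + 1) < (b : ℝ) ^ i := by
      rw [← mul_lt_mul_iff_left₀ hα0]
      linarith
    exact_mod_cast this
  refine ⟨(fun n => ((u (b ^ i * n + (j + 1)) : ℤ) : R)) - fun n => ((u (b ^ i * n + j) : ℤ) : R),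
    Submodule.sub_mem _ (Submodule.subset_span ⟨i, j + 1, hjb, rfl⟩)
      (Submodule.subset_span ⟨i, j, by omega, rfl⟩), fun s => ?_⟩
  simp only [Pi.sub_apply]
  split_ifs with hst
  · subst hst
    rw [hupper s (j + 1) hjb (by push_cast; linarith), hlower s j (by linarith)]
    push_cast
    ring
  · have h4 := h3 s hst
    rcases le_total (ρ s) (ρ t) with hle | hle
    · rw [abs_of_nonpos (by linarith)] at h4
      rw [hupper s (j + 1) hjb (by push_cast; linarith),
        hupper s j (by omega) (by linarith), sub_self]
    · rw [abs_of_nonneg (by linarith)] at h4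
      rw [hlower s (j + 1) (by push_cast; linarith), hlower s j (by linarith), sub_self]

theorem mainTheorem1 (R : Type*) [CommRing R] [IsNoetherianRing R] [Nontrivial R] :
    (∀ (b : ℕ), 2 ≤ b → ∀ (α β : ℝ),
      (∀ᶠ n : ℕ in Filter.atTop, 0 < α * n + β) →
      ∀ u : ℕ → ℤ, (∀ n : ℕ, 0 < α * n + β → u n = ⌊Real.logb b (α * n + β)⌋) →
        (IsRegularSeq R b (fun n => (u n : R)) ↔ α ∈ Set.range ((↑) : ℚ → ℝ))) ∧
    (∀ w : ℕ → ℤ, (∀ n : ℕ, 1 ≤ n → w n = ⌊(1 / 2 : ℝ) + Real.logb 2 n⌋) →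
        ¬ IsRegularSeq R 2 (fun n => (w n : R))) := by
  refine ⟨fun b hb α β hpos u hu => ⟨fun hreg => ?_, ?_⟩, fun w hw => ?_⟩
  · by_contra hα
    have hα' : Irrational α := hα
    exact not_isRegularSeq_of_irrational hb hα' (pos_of_eventually_pos hα'.ne_zero hpos) hu hreg
  · rintro ⟨r, rfl⟩
    exact isRegularSeq_of_rat hb r hpos hu
  -- Here `1/2 + log₂ n = log₂(√2 n)`.
  · refine not_isRegularSeq_of_irrational le_rfl irrational_sqrt_two
      (β := 0) (by positivity) fun n hn => ?_
    have hn0 : n ≠ 0 := by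
      rintro rfl
      simp at hn
    have hs : Real.logb 2 (√2) = 1 / 2 := by
      rw [Real.sqrt_eq_rpow, Real.logb_rpow (by norm_num) (by norm_num)]
    rw [hw n (Nat.one_le_iff_ne_zero.2 hn0), add_zero, Nat.cast_ofNat,
      Real.logb_mul (by positivity) (by exact_mod_cast hn0), hs]
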